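/- Let $L\ge 1$, $R$, $I_H,J_H,K_H,I_M,J_M,K_M$ be natural numbers, and let $P_1\in\mathbb R^{I_H\times I_M}$, $P_2\in\mathbb R^{J_H\times J_M}$, $P_M\in\mathbb R^{K_M\times K_H}$ be fixed matrices of full row rank. For a matrix $S$ and a vector $c$ let $S\circ c$ be the third-order tensor with entries $S_{ij}c_k$. Let $A_r\in\mathbb R^{I_M\times L}$, $B_r\in\mathbb R^{J_M\times L}$ ($r=1,\dots,R$) and $C\in\mathbb R^{K_H\times R}$ be random matrices whose joint distribution is absolutely continuous with respect to Lebesgue measure (for example, independent matrices, each with an absolutely continuous distribution). Let $$\underline Y_S=\sum_{r=1}^R (A_rB_r^\top)\circ C(:,r)\in\mathbb R^{I_M\times J_M\times K_H}$$ be the super-resolution image, and let $\underline Y_H\in\mathbb R^{I_H\times J_H\times K_H}$ and $\underline Y_M\in\mathbb R^{I_M\times J_M\times K_M}$ be the hyperspectral and the multispectral image, given by $\underline Y_H(:,:,k)=P_1\,\underline Y_S(:,:,k)\,P_2^\top$ for all $k$ and $\underline Y_M(i,j,:)=P_M\,\underline Y_S(i,j,:)$ for all $i,j$. The semi-blind coupled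 LL1 problem asks for matrices $\widetilde A_r\in\mathbb R^{I_H\times L}$, $\widetilde B_r\in\mathbb R^{J_H\times L}$, $A_r\in\mathbb R^{I_M\times L}$, $B_r\in\mathbb R^{J_M\times L}$ ($r=1,\dots,R$) and $C\in\mathbb R^{K_H\times R}$ with $$\underline Y_H=\sum_{r=1}^R(\widetilde A_r\widetilde B_r^\top)\circ C(:,r),\qquad \underline Y_M=\sum_{r=1}^R(A_rB_r^\top)\circ P_MC(:,r).$$ Assume $K_M\ge 2$, $I_HJ_H\ge L^2R$ and $$\min\left(\lfloor I_H/L\rfloor,R\right)+\min\left(\lfloor J_H/L\rfloor,R\right)+\min(K_M,R)\ge 2R+2.$$ Then, with probability one, the problem has a solution, and every solution $(\{\widetilde A_r^\star,\widetilde B_r^\star\}_{r=1}^R,\{A_r^\star,B_r^\star\}_{r=1}^R,C^\star)$ recovers the super-resolution image: $$\underline Y_S=\sum_{r=1}^R \left(A_r^\star (B_r^\star)^\top\right)\circ C^\star(:,r).$$ -/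

import Mathlib

open MeasureTheory

namespace CoupledLL1

/-- Real third-order tensors of size `I × J × K` (space, space, spectrum). -/
abbrev Tensor3 (I J K : ℕ) : Type := Fin I → Fin J → Fin K → ℝ

/-- The LL1 tensor `∑ r, (A r * (B r)ᵀ) ∘ C(:, r)`, where `S ∘ c` is the outer product, i.e. the
tensor with entries `S i j * c k`. -/
def ll1Tensor {I J K L R : ℕ} (A : Fin R → Matrix (Fin I) (Fin L) ℝ)
    (B : Fin R → Matrix (Fin J) (Fin L) ℝ) (C : Matrix (Fin K) (Fin R) ℝ) : Tensor3 I J K :=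
  fun i j k => ∑ r, (A r * (B r).transpose) i j * C k r

/-- Spatial degradation: every slab `Y(:, :, k)` is replaced by `P₁ * Y(:, :, k) * P₂ᵀ`. -/
def spatialDegradation {IH IM JH JM K : ℕ} (P₁ : Matrix (Fin IH) (Fin IM) ℝ)
    (P₂ : Matrix (Fin JH) (Fin JM) ℝ) (Y : Tensor3 IM JM K) : Tensor3 IH JH K :=
  fun i j k => (P₁ * Matrix.of (fun i' j' => Y i' j' k) * P₂.transpose) i j

/-- Spectral degradation: every tube `Y(i, j, :)` is replaced by `PM * Y(i, j, :)`. -/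
def spectralDegradation {I J KH KM : ℕ} (PM : Matrix (Fin KM) (Fin KH) ℝ)
    (Y : Tensor3 I J KH) : Tensor3 I J KM :=
  fun i j => PM.mulVec (Y i j)

/-- `(At, Bt, A, B, C)` solves the semi-blind coupled LL1 problem for the data `YH`, `YM`:
`YH = ∑ r, (At r * (Bt r)ᵀ) ∘ C(:, r)` and `YM = ∑ r, (A r * (B r)ᵀ) ∘ (PM * C(:, r))`.
The factors `At`, `Bt` are free; only `PM` is known. -/
def IsSemiBlindSolution {IH JH KH IM JM KM L R : ℕ} (PM : Matrix (Fin KM) (Fin KH) ℝ)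
    (YH : Tensor3 IH JH KH) (YM : Tensor3 IM JM KM)
    (At : Fin R → Matrix (Fin IH) (Fin L) ℝ) (Bt : Fin R → Matrix (Fin JH) (Fin L) ℝ)
    (A : Fin R → Matrix (Fin IM) (Fin L) ℝ) (B : Fin R → Matrix (Fin JM) (Fin L) ℝ)
    (C : Matrix (Fin KH) (Fin R) ℝ) : Prop :=
  YH = ll1Tensor At Bt C ∧ YM = ll1Tensor A B (PM * C)

/-- All entries of a triple of factors, as a point of a finite-dimensional coordinate space
(which carries its Lebesgue measure). -/
def entries {I J K L R : ℕ} (A : Fin R → Matrix (Fin I) (Fin L) ℝ)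
    (B : Fin R → Matrix (Fin J) (Fin L) ℝ) (C : Matrix (Fin K) (Fin R) ℝ) :
    (Fin R → Fin I → Fin L → ℝ) × (Fin R → Fin J → Fin L → ℝ) × (Fin K → Fin R → ℝ) :=
  (fun r i l => A r i l, fun r j l => B r j l, fun k r => C k r)

/-- The random factors `({A r, B r}, C)` have a joint distribution that is absolutely continuous
with respect to Lebesgue measure. -/
def HasAbsContLaw {Ω : Type*} [MeasurableSpace Ω] (μ : Measure Ω) {I J K L R : ℕ}
    (A : Ω → Fin R → Matrix (Fin I) (Fin L) ℝ) (B : Ω → Fin R → Matrix (Fin J) (Fin L) ℝ)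
    (C : Ω → Matrix (Fin K) (Fin R) ℝ) : Prop :=
  AEMeasurable (fun ω => entries (A ω) (B ω) (C ω)) μ ∧
    (μ.map (fun ω => entries (A ω) (B ω) (C ω))).AbsolutelyContinuous volume

end CoupledLL1

/-! Both degraded images are again LL1 tensors: the hyperspectral one has factors `P₁ * A r`, `P₂ *
B r`, `C`, and the multispectral one `A r`, `B r`, `PM * C`. The image is recovered because both
decompositions are essentially unique, by a block version of Kruskal's theorem
(`exists_perm_of_sum_smul_eq`).

Contracting the third mode with a functional `f` gives `∑ r, f (c r) • (A r * (B r)ᵀ)`. Sylvester's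
inequality bounds its rank below through the number of nonzero `f (c r)`, and any competing
decomposition bounds it above. Kruskal's permutation lemma `exists_perm_smul_eq` then matches the
third factors up to order and scale. Functionals supported on few indices match the products `A r *
(B r)ᵀ`.

The multispectral image thus determines the products and the columns of `PM * C`; the hyperspectral
image determines the columns of `C`. Each match has its own permutation and scales, but the columns
of `PM * C` are pairwise independent, so the two agree (`ll1Tensor_eq_of_isSemiBlindSolution`). The
rank conditions hold almost surely, since each follows from the nonvanishing of a polynomial that is
not identically zero (`ae_det_ne_zero`). -/

namespace CoupledLL1

/-! ### Kruskal's permutation lemma -/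

section Permutation

open Module Submodule

variable {E ι : Type*} [AddCommGroup E] [Module ℝ E] [Fintype ι]

open Classical in
/-- The number of members of the family `c` that lie in the subspace `V`. -/
noncomputable def memCount (c : ι → E) (V : Submodule ℝ E) : ℕ :=
  (Finset.univ.filter fun r => c r ∈ V).card

open Classical in
/-- The number of members of the family `c` on which the functional `f` does not vanish. -/
noncomputable def nonvanishingCount (c : ι → E) (f : Dual ℝ E) : ℕ :=
  (Finset.univ.filter fun r => f (c r) ≠ 0).card

/-- Some functional vanishes on `V` and on no member of a finite family outside `V`. -/
theorem exists_dual_apply_eq_zero_iff_mem {κ : Type*} [Finite κ] (V : Submodule ℝ E) (v : κ → E) :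
    ∃ f : Dual ℝ E, (∀ x ∈ V, f x = 0) ∧ ∀ i, f (v i) = 0 ↔ v i ∈ V := by
  -- Modulo `V` the members outside `V` are finitely many nonzero vectors, and some functional is
  -- nonzero on all of them.
  obtain ⟨g, hg⟩ := Module.exists_dual_forall_apply_ne_zero (K := ℝ)
    (fun i : {i // v i ∉ V} => V.mkQ (v i)) (fun i => by
      simpa [Submodule.Quotient.mk_eq_zero] using i.2)
  have h0 : ∀ x ∈ V, (g ∘ₗ V.mkQ) x = 0 := fun x hx => by
    have : V.mkQ x = 0 := by simpa [Submodule.Quotient.mk_eq_zero] using hx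
    rw [LinearMap.comp_apply, this, map_zero]
  refine ⟨g ∘ₗ V.mkQ, h0, fun i => ⟨fun h => ?_, h0 _⟩⟩
  by_contra hi
  exact hg ⟨i, hi⟩ h

/-- Steinitz exchange. It makes the one-step extensions of `V` partition the vectors outside `V`. -/
theorem sup_span_singleton_exchange {V : Submodule ℝ E} {x y : E} (hx : x ∈ V ⊔ span ℝ {y})
    (hxV : x ∉ V) : V ⊔ span ℝ {x} = V ⊔ span ℝ {y} := by
  obtain ⟨v, hv, w, hw, rfl⟩ := Submodule.mem_sup.1 hx
  obtain ⟨a, rfl⟩ := Submodule.mem_span_singleton.1 hw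
  have ha : a ≠ 0 := by
    rintro rfl
    exact hxV (by simpa using hv)
  refine le_antisymm (sup_le le_sup_left ?_) (sup_le le_sup_left ?_)
  · rwa [Submodule.span_singleton_le_iff_mem]
  · rw [Submodule.span_singleton_le_iff_mem]
    have h : -(a⁻¹ • v) + a⁻¹ • (v + a • y) = y := by
      rw [smul_add, smul_smul, inv_mul_cancel₀ ha]
      simp
    have h' := add_mem (mem_sup_left (neg_mem (V.smul_mem a⁻¹ hv)))
      (mem_sup_right (Submodule.smul_mem _ a⁻¹ (mem_span_singleton_self (R := ℝ) (v + a • y))))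
    rwa [h] at h'

theorem memCount_add_nonvanishingCount {c : ι → E} {V : Submodule ℝ E} {f : Dual ℝ E}
    (h : ∀ r, f (c r) = 0 ↔ c r ∈ V) : memCount c V + nonvanishingCount c f = Fintype.card ι := by
  classical
  unfold memCount nonvanishingCount
  simp_rw [ne_eq, h]
  exact Finset.card_filter_add_card_filter_not _

open Classical in
/-- A subspace `W` in the image of `r ↦ V ⊔ span {c r}` contains the members of `c` in `V`, and
otherwise those `c r` with `V ⊔ span {c r} = W`. -/
theorem memCount_sup_span_singleton (c : ι → E) (V : Submodule ℝ E) (y : E) :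
    memCount c (V ⊔ span ℝ {y}) = memCount c V +
      ((Finset.univ.filter fun r => c r ∉ V).filter
        fun r => V ⊔ span ℝ {c r} = V ⊔ span ℝ {y}).card := by
  unfold memCount
  rw [← Finset.card_union_of_disjoint]
  · congr 1
    ext r
    simp only [Finset.mem_filter, Finset.mem_univ, true_and, Finset.mem_union]
    constructor
    · intro h
      by_cases hr : c r ∈ V
      · exact Or.inl hr
      · exact Or.inr ⟨hr, sup_span_singleton_exchange h hr⟩
    · rintro (h | ⟨-, h⟩)
      · exact mem_sup_left h
      · exact h ▸ mem_sup_right (mem_span_singleton_self _)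
  · rw [Finset.disjoint_left]
    intro r h1 h2
    simp only [Finset.mem_filter, Finset.mem_univ, true_and] at h1 h2
    exact h2.1 h1

variable [FiniteDimensional ℝ E]

/-- The counting step in Kruskal's permutation lemma. -/
theorem memCount_le_memCount_span {c c' : ι → E} {k : ℕ} (hk : k ≤ Fintype.card ι)
    (hc : ∀ T : Finset ι, T.card ≤ k → LinearIndepOn ℝ c (T : Set ι))
    (h : ∀ f : Dual ℝ E, nonvanishingCount c' f + k ≤ Fintype.card ι + 1 →
      nonvanishingCount c f ≤ nonvanishingCount c' f) (S : Set ι) :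
    memCount c' (span ℝ (c' '' S)) ≤ memCount c (span ℝ (c' '' S)) := by
  classical
  -- Induction on the codimension: larger spans are settled first.
  induction hn : finrank ℝ E - finrank ℝ (span ℝ (c' '' S)) using Nat.strong_induction_on
    generalizing S with
  | _ n ih =>
  set V := span ℝ (c' '' S) with hV
  by_cases hcase : k ≤ memCount c' V + 1
  -- If `V` contains at least `k - 1` of the `c' r`, a functional vanishing exactly on the members
  -- in `V` is covered by `h`.
  · obtain ⟨f, -, hf⟩ := exists_dual_apply_eq_zero_iff_mem V (Sum.elim c c')
    have h1 := memCount_add_nonvanishingCount (c := c) (V := V) (f := f) fun r => hf (Sum.inl r)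
    have h2 := memCount_add_nonvanishingCount (c := c') (V := V) (f := f) fun r => hf (Sum.inr r)
    have h3 := h f (by omega)
    omega
  · push Not at hcase
    set D' := Finset.univ.filter fun r => c' r ∉ V
    set D := Finset.univ.filter fun r => c r ∉ V
    set q : E → Submodule ℝ E := fun y => V ⊔ span ℝ {y}
    set W := D'.image fun r => q (c' r)
    have hcount' : memCount c' V + D'.card = Fintype.card ι :=
      Finset.card_filter_add_card_filter_not _
    have hcount : memCount c V + D.card = Fintype.card ι :=
      Finset.card_filter_add_card_filter_not _
    have hfib' : D'.card = ∑ w ∈ W, (D'.filter fun r => q (c' r) = w).card :=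
      Finset.card_eq_sum_card_fiberwise fun r hr => Finset.mem_image_of_mem _ hr
    have hfib : ∑ w ∈ W, (D.filter fun r => q (c r) = w).card ≤ D.card :=
      (Finset.card_le_card (Finset.biUnion_subset.2 fun _ _ => Finset.filter_subset _ _)).trans'
        (Finset.card_biUnion fun _ _ _ _ hne => Finset.disjoint_filter.2
          fun _ _ h1 h2 => hne (h1.symm.trans h2)).ge
    have hq : ∀ j, q (c' j) = span ℝ (c' '' insert j S) := fun j => by
      rw [Set.image_insert_eq, span_insert, sup_comm]
    have hih : ∀ j ∈ D', memCount c' (q (c' j)) ≤ memCount c (q (c' j)) := by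
      intro j hj
      have hj' : c' j ∉ V := (Finset.mem_filter.1 hj).2
      have hlt : finrank ℝ V < finrank ℝ (q (c' j)) := by
        refine Submodule.finrank_lt_finrank_of_lt (lt_of_le_of_ne le_sup_left fun he => hj' ?_)
        rw [he]
        exact mem_sup_right (mem_span_singleton_self _)
      have hle : finrank ℝ (q (c' j)) ≤ finrank ℝ E := Submodule.finrank_le _
      rw [hq] at hlt hle ⊢
      exact ih _ (by omega) _ rfl
    have hsum : ∀ w ∈ W, memCount c' V + (D'.filter fun r => q (c' r) = w).card ≤
        memCount c V + (D.filter fun r => q (c r) = w).card := by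
      intro w hw
      obtain ⟨j, hj, rfl⟩ := Finset.mem_image.1 hw
      have := hih j hj
      rwa [memCount_sup_span_singleton c' V, memCount_sup_span_singleton c V] at this
    -- Summing over the extensions in `W` counts the members in `V` once for each extension and
    -- those outside at most once, with equality for `c'`.
    have htotal := Finset.sum_le_sum hsum
    rw [Finset.sum_add_distrib, Finset.sum_add_distrib, ← hfib', Finset.sum_const, Finset.sum_const,
      smul_eq_mul, smul_eq_mul] at htotal
    have hVrank : finrank ℝ V ≤ memCount c' V := by
      have hV' : V = span ℝ (((Finset.univ.filter fun r => c' r ∈ V).image c' : Finset E) : Set E) := by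
        refine le_antisymm (span_mono ?_) (span_le.2 ?_)
        · rintro _ ⟨r, hr, rfl⟩
          simpa using ⟨r, subset_span ⟨r, hr, rfl⟩, rfl⟩
        · intro x hx
          simp only [Finset.coe_image, Set.mem_image, Finset.coe_filter, Finset.mem_univ, true_and,
            Set.mem_ofPred_eq] at hx
          obtain ⟨r, hr, rfl⟩ := hx
          exact hr
      calc finrank ℝ V ≤ _ := by
            conv_lhs => rw [hV']
            exact finrank_span_finset_le_card _
        _ ≤ _ := Finset.card_image_le
    -- With a single extension, all `c' r`, hence by induction all `c r`, would lie in a space of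
    -- dimension at most `finrank V + 1 < k`, against the independence of `k` of the `c r`.
    have hW : 2 ≤ W.card := by
      by_contra hlt
      have hD' : D'.Nonempty := by
        rw [← Finset.card_pos]
        omega
      obtain ⟨j, hj⟩ := hD'
      have hW1 : ∀ r ∈ D', q (c' r) = q (c' j) := fun r hr =>
        Finset.card_le_one.1 (by omega : W.card ≤ 1) _ (Finset.mem_image_of_mem _ hr) _
          (Finset.mem_image_of_mem _ hj)
      have hall' : ∀ r, c' r ∈ q (c' j) := by
        intro r
        by_cases hr : c' r ∈ V
        · exact mem_sup_left hr
        · rw [← hW1 r (by simpa [D'] using hr)]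
          exact mem_sup_right (mem_span_singleton_self _)
      have hfull : memCount c' (q (c' j)) = Fintype.card ι := by
        simp [memCount, hall']
      have hfull2 : memCount c (q (c' j)) = Fintype.card ι :=
        le_antisymm (Finset.card_le_univ _) (hfull ▸ hih j hj)
      have hall : ∀ r, c r ∈ q (c' j) := by
        intro r
        have := (Finset.card_eq_iff_eq_univ _).1 hfull2
        have hr := Finset.mem_univ r
        rw [← this] at hr
        exact (Finset.mem_filter.1 hr).2
      obtain ⟨T, -, hT⟩ := Finset.exists_subset_card_eq (s := (Finset.univ : Finset ι)) hk
      have hTi : LinearIndependent ℝ (fun r : T => c r) := hc T hT.le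
      have hTspan : finrank ℝ (span ℝ (Set.range fun r : T => c r)) = k := by
        rw [finrank_span_eq_card hTi, Fintype.card_coe, hT]
      have h1 : finrank ℝ (span ℝ (Set.range fun r : T => c r)) ≤ finrank ℝ (q (c' j)) := by
        refine Submodule.finrank_mono (span_le.2 ?_)
        rintro _ ⟨r, rfl⟩
        exact hall r
      have h2 : finrank ℝ (q (c' j)) ≤ finrank ℝ V + 1 :=
        (Submodule.finrank_add_le_finrank_add_finrank _ _).trans
          (Nat.add_le_add_left ((finrank_span_le_card _).trans (by simp)) _)
      omega
    -- Since inside and outside counts have the same total for both families, `htotal` reduces to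
    -- the claim multiplied by `W.card - 1 > 0`.
    by_contra hlt
    push Not at hlt
    obtain ⟨m, hm⟩ := Nat.exists_eq_add_of_le hW
    rw [hm] at htotal
    nlinarith [Nat.mul_le_mul_left m hlt.le]

/-- **Kruskal's permutation lemma.** -/
theorem exists_perm_smul_eq {c c' : ι → E} {k : ℕ} (hk2 : 2 ≤ k) (hk : k ≤ Fintype.card ι)
    (hc : ∀ T : Finset ι, T.card ≤ k → LinearIndepOn ℝ c (T : Set ι))
    (h : ∀ f : Dual ℝ E, nonvanishingCount c' f + k ≤ Fintype.card ι + 1 →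
      nonvanishingCount c f ≤ nonvanishingCount c' f) :
    ∃ (σ : Equiv.Perm ι) (u : ι → ℝ), (∀ r, u r ≠ 0) ∧ ∀ r, c' r = u r • c (σ r) := by
  classical
  have hmain := memCount_le_memCount_span hk hc h
  have hc0 : ∀ r, c r ≠ 0 := fun r => by
    have := hc {r} (by simp; omega)
    simpa using this
  have hc'0 : ∀ r, c' r ≠ 0 := fun r hr => by
    -- The empty span is the zero space, which contains no `c r`.
    have h1 := hmain ∅
    have h2 : memCount c (span ℝ (c' '' ∅)) = 0 := by
      simp [memCount, hc0]
    have h3 : 0 < memCount c' (span ℝ (c' '' ∅)) :=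
      Finset.card_pos.2 ⟨r, by simp [hr]⟩
    omega
  have hline : ∀ y : E, memCount c (span ℝ {y}) ≤ 1 := by
    intro y
    refine Finset.card_le_one.2 fun a ha b hb => ?_
    simp only [Finset.mem_filter, Finset.mem_univ, true_and] at ha hb
    by_contra hab
    have hli := hc {a, b} ((Finset.card_pair hab).le.trans hk2)
    have hle : finrank ℝ (span ℝ (c '' {a, b})) ≤ finrank ℝ (span ℝ {y}) := by
      refine Submodule.finrank_mono (span_le.2 ?_)
      rintro _ ⟨r, rfl | rfl, rfl⟩ <;> assumption
    have hli' : LinearIndependent ℝ (fun r : ({a, b} : Finset ι) => c r) := hli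
    have hr := finrank_span_eq_card hli'
    rw [Fintype.card_coe, Finset.card_pair hab] at hr
    have hset : Set.range (fun r : ({a, b} : Finset ι) => c r) = c '' {a, b} := by
      ext x
      simp
    rw [hset] at hr
    have := finrank_span_le_card (R := ℝ) ({y} : Set E)
    simp at this
    omega
  have hex : ∀ j, ∃ i, c i ∈ span ℝ {c' j} := by
    intro j
    have h1 := hmain {j}
    rw [Set.image_singleton] at h1
    have h3 : 0 < memCount c' (span ℝ {c' j}) :=
      Finset.card_pos.2 ⟨j, by simp [mem_span_singleton_self]⟩
    obtain ⟨i, hi⟩ := Finset.card_pos.1 (h3.trans_le h1)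
    exact ⟨i, (Finset.mem_filter.1 hi).2⟩
  choose σ hσ using hex
  have hex2 : ∀ j, ∃ a : ℝ, a ≠ 0 ∧ c' j = a • c (σ j) := by
    intro j
    obtain ⟨a, ha⟩ := mem_span_singleton.1 (hσ j)
    have ha0 : a ≠ 0 := by
      rintro rfl
      exact hc0 (σ j) (by rw [← ha, zero_smul])
    exact ⟨a⁻¹, inv_ne_zero ha0, by rw [← ha, smul_smul, inv_mul_cancel₀ ha0, one_smul]⟩
  choose u hu0 hu using hex2
  have hinj : Function.Injective σ := by
    intro i j hij
    have h1 := hmain {j}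
    rw [Set.image_singleton] at h1
    have h2 := h1.trans (hline _)
    refine Finset.card_le_one.1 h2 i ?_ j ?_
    · simp only [Finset.mem_filter, Finset.mem_univ, true_and]
      rw [hu i, hij]
      exact Submodule.smul_mem _ _ (hσ j)
    · simp [mem_span_singleton_self]
  exact ⟨Equiv.ofBijective σ (Finite.injective_iff_bijective.1 hinj), u, hu0, hu⟩

end Permutation

end CoupledLL1

namespace CoupledLL1

/-! ### Block ranks and uniqueness of the LL1 decomposition -/

section BlockRank

open Module Matrix

variable {ι m n l : Type*} [Fintype l]

/-- The blocks `A r`, `r ∈ T`, next to each other in one matrix. -/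
def blockCols (A : ι → Matrix m l ℝ) (T : Finset ι) : Matrix m (T × l) ℝ :=
  Matrix.of fun i p => A p.1 i p.2

/-- The partitioned matrix with blocks `A r` has `k'`-rank at least `k`: any `k` of its blocks
together have full column rank. -/
def HasBlockRank (A : ι → Matrix m l ℝ) (k : ℕ) : Prop :=
  ∀ T : Finset ι, T.card ≤ k → LinearIndependent ℝ (blockCols A T).col

theorem blockCols_mul_transpose (A : ι → Matrix m l ℝ) (B : ι → Matrix n l ℝ) (T : Finset ι) :
    blockCols A T * (blockCols B T)ᵀ = ∑ r ∈ T, A r * (B r)ᵀ := by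
  ext i j
  simp only [Matrix.mul_apply, Matrix.sum_apply, Matrix.transpose_apply, blockCols, Matrix.of_apply,
    Fintype.sum_prod_type]
  exact Finset.sum_coe_sort T fun r => ∑ x, A r i x * B r j x

theorem blockCols_smul_mul_transpose (A : ι → Matrix m l ℝ) (B : ι → Matrix n l ℝ) (d : ι → ℝ)
    (T : Finset ι) :
    blockCols (fun r => d r • A r) T * (blockCols B T)ᵀ = ∑ r ∈ T, d r • (A r * (B r)ᵀ) := by
  simp only [blockCols_mul_transpose, Matrix.smul_mul]

theorem sum_mulVec_eq_blockCols_mulVec (A : ι → Matrix m l ℝ) (y : ι → l → ℝ) (T : Finset ι) :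
    ∑ r ∈ T, A r *ᵥ y r = blockCols A T *ᵥ fun p => y p.1 p.2 := by
  ext i
  simp only [Finset.sum_apply, Matrix.mulVec, dotProduct, blockCols, Matrix.of_apply,
    Fintype.sum_prod_type]
  exact (Finset.sum_coe_sort T fun r => ∑ x, A r i x * y r x).symm

theorem HasBlockRank.eq_of_sum_mulVec_eq {A : ι → Matrix m l ℝ} {k : ℕ} (hA : HasBlockRank A k)
    {T : Finset ι} (hT : T.card ≤ k) {y z : ι → l → ℝ}
    (h : ∑ r ∈ T, A r *ᵥ y r = ∑ r ∈ T, A r *ᵥ z r) : ∀ r ∈ T, y r = z r := by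
  rw [sum_mulVec_eq_blockCols_mulVec, sum_mulVec_eq_blockCols_mulVec] at h
  have := Matrix.mulVec_injective_iff.2 (hA T hT) h
  intro r hr
  ext x
  exact congrFun this (⟨r, hr⟩, x)

theorem rank_of_linearIndependent_col [Fintype n] [Fintype m] {M : Matrix m n ℝ}
    (h : LinearIndependent ℝ M.col) : M.rank = Fintype.card n := by
  rw [← Matrix.rank_transpose]
  exact LinearIndependent.rank_matrix (M := Mᵀ) h

theorem HasBlockRank.min_mul_card_le_rank [Fintype m] {A : ι → Matrix m l ℝ} {k : ℕ}
    (hA : HasBlockRank A k) (T : Finset ι) :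
    min T.card k * Fintype.card l ≤ (blockCols A T).rank := by
  obtain ⟨T', hT', hcard⟩ := Finset.exists_subset_card_eq (min_le_left T.card k)
  have h := rank_of_linearIndependent_col (hA T' (hcard ▸ min_le_right _ _))
  rw [Fintype.card_prod, Fintype.card_coe, hcard] at h
  rw [← h]
  exact Matrix.rank_submatrix_le (blockCols A T) id
    (fun p : T' × l => ((⟨p.1, hT' p.1.2⟩, p.2) : T × l))

theorem rank_blockCols_smul [Fintype m] (A : ι → Matrix m l ℝ) (d : ι → ℝ) (T : Finset ι)
    (hd : ∀ r ∈ T, d r ≠ 0) : (blockCols (fun r => d r • A r) T).rank = (blockCols A T).rank := by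
  classical
  have h : blockCols (fun r => d r • A r) T =
      blockCols A T * Matrix.diagonal fun p : T × l => d p.1 := by
    ext i p
    simp [blockCols, mul_comm]
  rw [h]
  refine Matrix.rank_mul_eq_left_of_det_ne_zero _ _ ?_
  rw [Matrix.det_diagonal]
  exact Finset.prod_ne_zero_iff.2 fun p _ => hd _ p.1.2

/-- **Sylvester's rank inequality.** -/
theorem rank_add_rank_le_card_add_rank_mul {p : Type*} [Fintype m] [Fintype n] [Fintype p]
    (M : Matrix m n ℝ) (N : Matrix n p ℝ) :
    M.rank + N.rank ≤ Fintype.card n + (M * N).rank := by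
  have h1 := LinearMap.finrank_range_add_finrank_ker M.mulVecLin
  have h2 := LinearMap.finrank_range_add_finrank_ker
    (M.mulVecLin.domRestrict (LinearMap.range N.mulVecLin))
  have h3 : LinearMap.range (M.mulVecLin.domRestrict (LinearMap.range N.mulVecLin)) =
      LinearMap.range (M * N).mulVecLin := by
    rw [Matrix.mulVecLin_mul, LinearMap.range_domRestrict, LinearMap.range_comp]
  have h4 : finrank ℝ (LinearMap.ker (M.mulVecLin.domRestrict (LinearMap.range N.mulVecLin))) ≤
      finrank ℝ (LinearMap.ker M.mulVecLin) := by
    rw [← Submodule.finrank_map_subtype_eq]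
    refine Submodule.finrank_mono ?_
    rintro _ ⟨x, hx, rfl⟩
    exact hx
  rw [h3] at h2
  rw [Module.finrank_fintype_fun_eq_card] at h1
  unfold Matrix.rank
  omega

variable [Fintype ι]

-- Dropping zero coefficients makes the inner dimension of the product proportional to the number of
-- nonzero ones, which is what the rank estimates need.
open Classical in
theorem sum_smul_eq_blockCols_support (A : ι → Matrix m l ℝ) (B : ι → Matrix n l ℝ) (d : ι → ℝ) :
    ∑ r, d r • (A r * (B r)ᵀ) = blockCols (fun r => d r • A r) (Finset.univ.filter (d · ≠ 0)) *
      (blockCols B (Finset.univ.filter (d · ≠ 0)))ᵀ := by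
  rw [blockCols_smul_mul_transpose]
  refine (Finset.sum_subset (Finset.filter_subset _ _) fun r _ hr => ?_).symm
  have : d r = 0 := by simpa using hr
  rw [this, zero_smul]

open Classical in
/-- Two combinations of rank-`l` products can agree only if the numbers of their non-zero
coefficients satisfy Kruskal's inequality. -/
theorem HasBlockRank.min_add_min_le [Fintype m] [Fintype n] [Nonempty l]
    {A A' : ι → Matrix m l ℝ} {B B' : ι → Matrix n l ℝ} {kA kB : ℕ} (hA : HasBlockRank A kA)
    (hB : HasBlockRank B kB) {d d' : ι → ℝ}
    (h : ∑ r, d r • (A r * (B r)ᵀ) = ∑ r, d' r • (A' r * (B' r)ᵀ)) :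
    min (Finset.univ.filter (d · ≠ 0)).card kA + min (Finset.univ.filter (d · ≠ 0)).card kB ≤
      (Finset.univ.filter (d · ≠ 0)).card + (Finset.univ.filter (d' · ≠ 0)).card := by
  rw [sum_smul_eq_blockCols_support, sum_smul_eq_blockCols_support] at h
  set T := Finset.univ.filter (d · ≠ 0)
  set T' := Finset.univ.filter (d' · ≠ 0)
  have h1 := rank_add_rank_le_card_add_rank_mul (blockCols (fun r => d r • A r) T)
    (blockCols B T)ᵀ
  have h2 : (blockCols (fun r => d r • A r) T * (blockCols B T)ᵀ).rank ≤
      T'.card * Fintype.card l := by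
    rw [h]
    refine (Matrix.rank_mul_le_left _ _).trans ((Matrix.rank_le_card_width _).trans ?_)
    rw [Fintype.card_prod, Fintype.card_coe]
  rw [rank_blockCols_smul A d T fun r hr => (Finset.mem_filter.1 hr).2, Matrix.rank_transpose,
    Fintype.card_prod, Fintype.card_coe] at h1
  have h3 := hA.min_mul_card_le_rank T
  have h4 := hB.min_mul_card_le_rank T
  have h5 : 0 < Fintype.card l := Fintype.card_pos
  refine Nat.le_of_mul_le_mul_right ?_ h5
  rw [add_mul, add_mul]
  omega

/-- Any `k` members of the family `c` are linearly independent, so some functional vanishes on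
exactly the members outside a given set `T` of the right size. -/
theorem exists_dual_apply_ne_zero_iff {E : Type*} [AddCommGroup E] [Module ℝ E] {c : ι → E} {k : ℕ}
    (hc : ∀ T : Finset ι, T.card ≤ k → LinearIndepOn ℝ c (T : Set ι)) {T : Finset ι}
    (hT : Fintype.card ι + 1 ≤ T.card + k) : ∃ f : Dual ℝ E, ∀ r, f (c r) ≠ 0 ↔ r ∈ T := by
  classical
  obtain ⟨f, -, hf⟩ := exists_dual_apply_eq_zero_iff_mem
    (Submodule.span ℝ (c '' ((Tᶜ : Finset ι) : Set ι))) c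
  refine ⟨f, fun r => ?_⟩
  rw [ne_eq, hf]
  have hcard := Finset.card_compl T
  have hle := Finset.card_le_univ T
  constructor
  · intro h
    by_contra hr
    exact h (Submodule.subset_span ⟨r, by simpa using hr, rfl⟩)
  · intro hr
    have hli := hc (insert r Tᶜ) ((Finset.card_insert_le _ _).trans (by omega))
    rw [Finset.coe_insert] at hli
    exact hli.notMem_span_of_insert (by simpa using hr)

/-- If the third factors agree, then the columns of each new block lie in the column space of
the corresponding old block. -/
theorem exists_mulVec_eq [Fintype m] [Fintype n] {A A' : ι → Matrix m l ℝ}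
    {B B' : ι → Matrix n l ℝ} {kA kB s : ℕ} (hA : HasBlockRank A kA) (hB : HasBlockRank B kB)
    (hs : 1 ≤ s) (hsι : s < Fintype.card ι) (hsA : s + 1 ≤ kA) (hsB : s ≤ kB)
    (h : ∀ T : Finset ι, T.card = s → ∃ d : ι → ℝ, (∀ r ∈ T, d r ≠ 0) ∧
      ∑ r ∈ T, d r • (A r * (B r)ᵀ) = ∑ r ∈ T, d r • (A' r * (B' r)ᵀ)) (r : ι) (z : l → ℝ) :
    ∃ y : l → ℝ, A' r *ᵥ z = A r *ᵥ y := by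
  classical
  have hspan : ∀ T : Finset ι, T.card = s → r ∈ T →
      ∃ y : ι → l → ℝ, (∀ t ∉ T, y t = 0) ∧ A' r *ᵥ z = ∑ t ∈ T, A t *ᵥ y t := by
    intro T hT hr
    obtain ⟨d, hd, he⟩ := h T hT
    rw [← blockCols_smul_mul_transpose, ← blockCols_smul_mul_transpose] at he
    have hr1 := rank_add_rank_le_card_add_rank_mul (blockCols (fun r => d r • A r) T)
      (blockCols B T)ᵀ
    rw [rank_blockCols_smul A d T hd, Matrix.rank_transpose,
      rank_of_linearIndependent_col (hB T (by omega)),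
      rank_of_linearIndependent_col (hA T (by omega))] at hr1
    have hle' : LinearMap.range (blockCols (fun r => d r • A r) T * (blockCols B T)ᵀ).mulVecLin ≤
        LinearMap.range (blockCols (fun r => d r • A' r) T).mulVecLin := by
      rw [he, Matrix.mulVecLin_mul]
      exact LinearMap.range_comp_le_range _ _
    have hle : LinearMap.range (blockCols (fun r => d r • A r) T * (blockCols B T)ᵀ).mulVecLin ≤
        LinearMap.range (blockCols (fun r => d r • A r) T).mulVecLin := by
      rw [Matrix.mulVecLin_mul]
      exact LinearMap.range_comp_le_range _ _
    -- By Sylvester the common product has full rank `T.card * Fintype.card l`, so its column space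
    -- is all of that of the new blocks over `T`.
    have heq := Submodule.eq_of_le_of_finrank_le hle'
      ((Matrix.rank_le_card_width (blockCols (fun r => d r • A' r) T)).trans (by
        unfold Matrix.rank at hr1; omega))
    rw [heq] at hle
    have hmem : A' r *ᵥ z ∈ LinearMap.range (blockCols (fun r => d r • A' r) T).mulVecLin := by
      refine ⟨fun p => (Pi.single r ((d r)⁻¹ • z) : ι → l → ℝ) p.1 p.2, ?_⟩
      rw [Matrix.mulVecLin_apply,
        ← sum_mulVec_eq_blockCols_mulVec _ (Pi.single r ((d r)⁻¹ • z) : ι → l → ℝ),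
        Finset.sum_eq_single_of_mem r hr]
      · rw [Pi.single_eq_same, Matrix.smul_mulVec, Matrix.mulVec_smul, smul_smul,
          mul_inv_cancel₀ (hd r hr), one_smul]
      · intro t _ ht
        rw [Pi.single_eq_of_ne ht, Matrix.mulVec_zero]
    obtain ⟨w, hw⟩ := hle hmem
    refine ⟨fun t x => if ht : t ∈ T then d t * w (⟨t, ht⟩, x) else 0, fun t ht => ?_, ?_⟩
    · ext x
      simp [ht]
    · rw [← hw, Matrix.mulVecLin_apply, sum_mulVec_eq_blockCols_mulVec]
      ext i
      simp only [Matrix.mulVec, dotProduct, blockCols, Matrix.of_apply, Matrix.smul_apply,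
        smul_eq_mul]
      refine Finset.sum_congr rfl fun p _ => ?_
      rw [dif_pos p.1.2]
      ring
  obtain ⟨T, hrT, -, hT⟩ := Finset.exists_subsuperset_card_eq (s := {r}) (t := Finset.univ)
    (n := s) (Finset.subset_univ _) (by simpa using hs) hsι.le
  rw [Finset.singleton_subset_iff] at hrT
  obtain ⟨y, hy0, hy⟩ := hspan T hT hrT
  refine ⟨y r, ?_⟩
  rw [hy, Finset.sum_eq_single_of_mem r hrT]
  intro t ht htr
  -- Exchanging `t` for `u` gives a second expansion of the same vector without block `t`. The two
  -- involve only `s + 1` blocks, which are jointly independent, so the `t` component is zero.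
  obtain ⟨u, hu⟩ : ∃ u, u ∉ T := by
    by_contra! hall
    rw [Finset.eq_univ_of_forall hall, Finset.card_univ] at hT
    omega
  have hu' : u ∉ T.erase t := fun hmem => hu (Finset.mem_of_mem_erase hmem)
  obtain ⟨y', hy0', hy'⟩ := hspan (insert u (T.erase t))
    (by rw [Finset.card_insert_of_notMem hu', Finset.card_erase_of_mem ht]; omega)
    (Finset.mem_insert_of_mem (Finset.mem_erase.2 ⟨htr.symm, hrT⟩))
  have htu : t ≠ u := fun he => hu (he ▸ ht)
  have hsub : insert u (T.erase t) ⊆ insert u T :=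
    Finset.insert_subset_insert _ (Finset.erase_subset _ _)
  have hext : ∑ t ∈ insert u T, A t *ᵥ y t = ∑ t ∈ insert u T, A t *ᵥ y' t := by
    rw [← Finset.sum_subset (Finset.subset_insert u T) fun a _ ha => by
        rw [hy0 a ha, Matrix.mulVec_zero], ← Finset.sum_subset hsub fun a _ ha => by
        rw [hy0' a ha, Matrix.mulVec_zero], ← hy, hy']
  have := hA.eq_of_sum_mulVec_eq (by rw [Finset.card_insert_of_notMem hu]; omega) hext t
    (Finset.mem_insert_of_mem ht)
  rw [this, hy0' t (by simp [htu]), Matrix.mulVec_zero]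

/-- If the third factors agree, then so do the matrix factors. -/
theorem mul_transpose_eq_of_sum_smul_eq [Fintype m] [Fintype n] {A A' : ι → Matrix m l ℝ}
    {B B' : ι → Matrix n l ℝ} {kA kB s : ℕ} (hA : HasBlockRank A kA) (hB : HasBlockRank B kB)
    (hs : 1 ≤ s) (hsι : s < Fintype.card ι) (hsA : s + 1 ≤ kA) (hsB : s ≤ kB)
    (h : ∀ T : Finset ι, T.card = s → ∃ d : ι → ℝ, (∀ r ∈ T, d r ≠ 0) ∧
      ∑ r ∈ T, d r • (A r * (B r)ᵀ) = ∑ r ∈ T, d r • (A' r * (B' r)ᵀ)) (r : ι) :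
    A' r * (B' r)ᵀ = A r * (B r)ᵀ := by
  classical
  obtain ⟨T, hrT, -, hT⟩ := Finset.exists_subsuperset_card_eq (s := {r}) (t := Finset.univ)
    (n := s) (Finset.subset_univ _) (by simpa using hs) hsι.le
  rw [Finset.singleton_subset_iff] at hrT
  obtain ⟨d, hd, he⟩ := h T hT
  refine Matrix.toLin'.injective (LinearMap.ext fun x => ?_)
  rw [Matrix.toLin'_apply, Matrix.toLin'_apply]
  have hy := fun t => exists_mulVec_eq hA hB hs hsι hsA hsB h t ((B' t)ᵀ *ᵥ x)
  choose y hy using hy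
  have hx := congrArg (· *ᵥ x) he
  simp only [Matrix.sum_mulVec, Matrix.smul_mulVec, ← Matrix.mulVec_mulVec, hy,
    ← Matrix.mulVec_smul] at hx
  have hdxy := hA.eq_of_sum_mulVec_eq (by omega) hx r hrT
  rw [Matrix.mulVec_smul] at hdxy
  -- Coordinates with respect to the old blocks are unique, so `y r` is forced.
  have hxy : (B r)ᵀ *ᵥ x = y r := smul_right_injective (l → ℝ) (hd r hrT) hdxy
  rw [← Matrix.mulVec_mulVec, ← Matrix.mulVec_mulVec, hy, hxy]

/-- **Uniqueness of the LL1 decomposition** under a Kruskal-type condition, with the tensor seen as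
the family of its contractions with functionals. -/
theorem exists_perm_of_sum_smul_eq [Fintype m] [Fintype n] [Nonempty l] {E : Type*}
    [AddCommGroup E] [Module ℝ E] [FiniteDimensional ℝ E] {A A' : ι → Matrix m l ℝ}
    {B B' : ι → Matrix n l ℝ} {c c' : ι → E} {kA kB kC : ℕ} (hA : HasBlockRank A kA)
    (hB : HasBlockRank B kB) (hc : ∀ T : Finset ι, T.card ≤ kC → LinearIndepOn ℝ c (T : Set ι))
    (hkA : kA ≤ Fintype.card ι) (hkB : kB ≤ Fintype.card ι) (hkC : kC ≤ Fintype.card ι)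
    (hk : 2 * Fintype.card ι + 2 ≤ kA + kB + kC)
    (h : ∀ f : Dual ℝ E, ∑ r, f (c r) • (A r * (B r)ᵀ) = ∑ r, f (c' r) • (A' r * (B' r)ᵀ)) :
    ∃ (σ : Equiv.Perm ι) (u : ι → ℝ), (∀ r, u r ≠ 0) ∧ (∀ r, c' r = u r • c (σ r)) ∧
      ∀ r, u r • (A' r * (B' r)ᵀ) = A (σ r) * (B (σ r))ᵀ := by
  classical
  obtain ⟨σ, u, hu0, hu⟩ := exists_perm_smul_eq (by omega) hkC hc (c' := c') fun f hf => by
    have h1 := hA.min_add_min_le hB (h f)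
    have h2 : nonvanishingCount c f ≤ Fintype.card ι := Finset.card_le_univ _
    have h3 : nonvanishingCount c f = (Finset.univ.filter fun r => f (c r) ≠ 0).card := by
      unfold nonvanishingCount; congr
    have h4 : nonvanishingCount c' f = (Finset.univ.filter fun r => f (c' r) ≠ 0).card := by
      unfold nonvanishingCount; congr
    omega
  refine ⟨σ, u, hu0, hu, fun r => ?_⟩
  -- The new blocks are reordered and absorb the scales. The value `s = card ι + 1 - kC` is the
  -- smallest support for which `exists_dual_apply_ne_zero_iff` applies; `hk` with `kA, kB ≤ card ι`
  -- gives `s + 1 ≤ kA, kB`.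
  have key := mul_transpose_eq_of_sum_smul_eq hA hB (A' := fun r => u (σ.symm r) • A' (σ.symm r))
    (B' := fun r => B' (σ.symm r)) (s := Fintype.card ι + 1 - kC) (by omega) (by omega) (by omega)
    (by omega) (fun T hT => by
      obtain ⟨f, hf⟩ := exists_dual_apply_ne_zero_iff hc (T := T) (by omega)
      refine ⟨fun r => f (c r), fun r hr => (hf r).2 hr, ?_⟩
      have hz : ∀ r ∉ T, f (c r) = 0 := fun r hr => by
        by_contra hne
        exact hr ((hf r).1 hne)
      rw [Finset.sum_subset (Finset.subset_univ T) fun r _ hr => by simp only [hz r hr, zero_smul],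
        Finset.sum_subset (Finset.subset_univ T) fun r _ hr => by simp only [hz r hr, zero_smul], h,
        ← Equiv.sum_comp σ fun r => f (c r) • (u (σ.symm r) • A' (σ.symm r) * (B' (σ.symm r))ᵀ)]
      refine Finset.sum_congr rfl fun r _ => ?_
      rw [hu, map_smul, σ.symm_apply_apply, Matrix.smul_mul, smul_smul, smul_eq_mul, mul_comm])
    (σ r)
  rw [σ.symm_apply_apply, Matrix.smul_mul] at key
  exact key

end BlockRank

end CoupledLL1

namespace CoupledLL1

/-! ### Genericity of the rank conditions -/

section Generic

open Module Matrix Polynomial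

variable {V : Type*} [NormedAddCommGroup V] [NormedSpace ℝ V] [FiniteDimensional ℝ V]
  [MeasurableSpace V] [BorelSpace V] (ν : Measure V) [ν.IsAddHaarMeasure]

/-- A determinant depending linearly on a parameter is almost everywhere non-zero as soon as it is
non-zero somewhere. -/
theorem ae_det_ne_zero {n : Type*} [Fintype n] [DecidableEq n] (Φ : V →ₗ[ℝ] Matrix n n ℝ) {v₀ : V}
    (h₀ : (Φ v₀).det ≠ 0) : ∀ᵐ v ∂ν, (Φ v).det ≠ 0 := by
  have hcont : Continuous fun v => (Φ v).det :=
    (LinearMap.continuous_of_finiteDimensional Φ).matrix_det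
  -- It suffices to work on lines in direction `v₀`. There the determinant is a polynomial in `t`
  -- with top coefficient `det (Φ v₀) ≠ 0`, so it has finitely many zeros.
  refine ae_mem_of_ae_add_linearMap_mem (LinearMap.toSpanSingleton ℝ V v₀) volume ν
    (s := {v | (Φ v).det ≠ 0}) (isOpen_ne_fun hcont continuous_const).measurableSet fun v => ?_
  set p : ℝ[X] := det ((X : ℝ[X]) • (Φ v₀).map C + (Φ v).map C)
  have hp : p ≠ 0 := fun hp => h₀ <| by
    rw [← coeff_det_X_add_C_card (Φ v₀) (Φ v)]
    exact (congrArg (coeff · _) hp).trans (coeff_zero _)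
  have heval : ∀ t : ℝ, p.eval t = (Φ (v + t • v₀)).det := fun t => by
    rw [← coe_evalRingHom, RingHom.map_det]
    congr 1
    ext i j
    simp
    ring
  refine measure_mono_null (fun t ht => ?_) (p.roots.toFinset.finite_toSet.measure_zero volume)
  have ht' : (Φ (v + t • v₀)).det = 0 := by
    by_contra hne
    exact ht hne
  simpa [hp, heval] using ht'

/-- If `P` has full row rank, then generically at most as many vectors `P *ᵥ x` as `P` has rows
are linearly independent. -/
theorem ae_linearIndependent_mulVec {m n κ : Type*} [Fintype m] [Fintype n] [Fintype κ]
    {P : Matrix m n ℝ} (hP : P.rank = Fintype.card m) (hκ : Fintype.card κ ≤ Fintype.card m)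
    (ψ : V →ₗ[ℝ] κ → n → ℝ) (hψ : Function.Surjective ψ) :
    ∀ᵐ v ∂ν, LinearIndependent ℝ fun i => P *ᵥ ψ v i := by
  classical
  obtain ⟨e⟩ := Function.Embedding.nonempty_of_card_le hκ
  have hsurj : Function.Surjective P.mulVecLin := by
    rw [← LinearMap.range_eq_top]
    refine Submodule.eq_top_of_finrank_eq ?_
    rw [finrank_fintype_fun_eq_card]
    exact hP
  let Φ : V →ₗ[ℝ] Matrix κ κ ℝ :=
    { toFun := fun v => Matrix.of fun i j => (P *ᵥ ψ v j) (e i)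
      map_add' := fun v w => by
        ext i j
        simp [Matrix.mulVec_add]
      map_smul' := fun a v => by
        ext i j
        simp [Matrix.mulVec_smul] }
  -- Vectors that `P` sends to distinct standard basis vectors make the minor on the rows `e` the
  -- identity.
  choose w hw using fun j : κ => hsurj (Pi.single (e j) 1)
  obtain ⟨v₀, hv₀⟩ := hψ w
  have h₀ : Φ v₀ = 1 := by
    ext i j
    have := congrFun (hw j) (e i)
    rw [Matrix.mulVecLin_apply] at this
    simp [Φ, hv₀, this, Pi.single_apply, Matrix.one_apply]
  filter_upwards [ae_det_ne_zero ν Φ (v₀ := v₀) (by simp [h₀])] with v hv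
  have hli : LinearIndependent ℝ (Φ v).col :=
    Matrix.linearIndependent_cols_iff_isUnit.2
      ((Matrix.isUnit_iff_isUnit_det _).2 (isUnit_iff_ne_zero.2 hv))
  exact LinearIndependent.of_comp (LinearMap.funLeft ℝ ℝ e) hli

/-- Generically the partitioned matrix with blocks `P * A r` has `k'`-rank at least
`⌊(number of rows of P) / (number of columns of A r)⌋`. -/
theorem ae_hasBlockRank_mul {m n l ι : Type*} [Fintype m] [Fintype n] [Fintype l] [Fintype ι]
    {P : Matrix m n ℝ} (hP : P.rank = Fintype.card m) (ψ : V →ₗ[ℝ] ι → Matrix n l ℝ)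
    (hψ : Function.Surjective ψ) {k : ℕ} (hk : k * Fintype.card l ≤ Fintype.card m) :
    ∀ᵐ v ∂ν, HasBlockRank (fun r => P * ψ v r) k := by
  classical
  simp only [HasBlockRank]
  refine ae_all_iff.2 fun T => ?_
  by_cases hT : T.card ≤ k
  swap
  · exact Filter.Eventually.of_forall fun v h => absurd h hT
  let χ : V →ₗ[ℝ] (T × l) → n → ℝ :=
    { toFun := fun v p i => ψ v p.1 i p.2
      map_add' := fun v w => by
        ext p i
        simp
      map_smul' := fun a v => by
        ext p i
        simp }
  have hχ : Function.Surjective χ := by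
    intro g
    obtain ⟨v, hv⟩ := hψ fun r => Matrix.of fun i x => if h : r ∈ T then g (⟨r, h⟩, x) i else 0
    refine ⟨v, ?_⟩
    ext p i
    simp [χ, hv]
  filter_upwards [ae_linearIndependent_mulVec ν hP (by
    rw [Fintype.card_prod, Fintype.card_coe]
    exact (Nat.mul_le_mul_right _ hT).trans hk) χ hχ] with v hv _
  exact hv

/-- Generically the columns of `P * M` are linearly independent, as many at a time as `P` has
rows. -/
theorem ae_linearIndepOn_col_mul {m n ι : Type*} [Fintype m] [Fintype n] [Fintype ι]
    {P : Matrix m n ℝ} (hP : P.rank = Fintype.card m) (ψ : V →ₗ[ℝ] Matrix n ι ℝ)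
    (hψ : Function.Surjective ψ) :
    ∀ᵐ v ∂ν, ∀ T : Finset ι, T.card ≤ Fintype.card m →
      LinearIndepOn ℝ (P * ψ v).col (T : Set ι) := by
  classical
  refine ae_all_iff.2 fun T => ?_
  by_cases hT : T.card ≤ Fintype.card m
  swap
  · exact Filter.Eventually.of_forall fun v h => absurd h hT
  let χ : V →ₗ[ℝ] T → n → ℝ :=
    { toFun := fun v r i => ψ v i r
      map_add' := fun v w => by
        ext p i
        simp
      map_smul' := fun a v => by
        ext p i
        simp }
  have hχ : Function.Surjective χ := by
    intro g
    obtain ⟨v, hv⟩ := hψ (Matrix.of fun i r => if h : r ∈ T then g ⟨r, h⟩ i else 0)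
    refine ⟨v, ?_⟩
    ext p i
    simp [χ, hv]
  filter_upwards [ae_linearIndependent_mulVec ν hP (by simpa using hT) χ hχ] with v hv _
  exact hv

end Generic

/-! ### Recovery of the super-resolution image -/

section Main

/-- Lebesgue measure on the space of all entries of the factors is an additive Haar measure. -/
theorem isAddHaarMeasure_volume_entries (I J K L R : ℕ) :
    (volume : Measure ((Fin R → Fin I → Fin L → ℝ) × (Fin R → Fin J → Fin L → ℝ) ×
      (Fin K → Fin R → ℝ))).IsAddHaarMeasure := by
  have h (a b : ℕ) : (volume : Measure (Fin a → Fin b → ℝ)).IsAddHaarMeasure :=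
    Measure.pi.isAddHaarMeasure _
  have h' (a b c : ℕ) : (volume : Measure (Fin a → Fin b → Fin c → ℝ)).IsAddHaarMeasure :=
    Measure.pi.isAddHaarMeasure _
  have h'' :
      (volume : Measure ((Fin R → Fin J → Fin L → ℝ) × (Fin K → Fin R → ℝ))).IsAddHaarMeasure :=
    Measure.prod.instIsAddHaarMeasure _ _
  have : MeasurableAdd ((Fin R → Fin J → Fin L → ℝ) × (Fin K → Fin R → ℝ)) :=
    ContinuousAdd.measurableAdd
  exact Measure.prod.instIsAddHaarMeasure _ _

open Module Matrix

variable {I J K L R : ℕ}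

theorem dual_apply_ll1Tensor (A : Fin R → Matrix (Fin I) (Fin L) ℝ)
    (B : Fin R → Matrix (Fin J) (Fin L) ℝ) (C : Matrix (Fin K) (Fin R) ℝ)
    (f : Dual ℝ (Fin K → ℝ)) (i : Fin I) (j : Fin J) :
    f (ll1Tensor A B C i j) = (∑ r, f (C.col r) • (A r * (B r)ᵀ)) i j := by
  have h : ll1Tensor A B C i j = ∑ r, (A r * (B r)ᵀ) i j • C.col r := by
    ext k
    simp [ll1Tensor]
  rw [h, map_sum, Matrix.sum_apply]
  refine Finset.sum_congr rfl fun r _ => ?_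
  rw [map_smul, Matrix.smul_apply, smul_eq_mul, smul_eq_mul, mul_comm]

/-- **Uniqueness of the LL1 decomposition** under a Kruskal-type condition. -/
theorem exists_perm_of_ll1Tensor_eq (hL : 1 ≤ L) {A A' : Fin R → Matrix (Fin I) (Fin L) ℝ}
    {B B' : Fin R → Matrix (Fin J) (Fin L) ℝ} {C C' : Matrix (Fin K) (Fin R) ℝ} {kA kB kC : ℕ}
    (hA : HasBlockRank A kA) (hB : HasBlockRank B kB)
    (hC : ∀ T : Finset (Fin R), T.card ≤ kC → LinearIndepOn ℝ C.col (T : Set (Fin R)))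
    (hkA : kA ≤ R) (hkB : kB ≤ R) (hkC : kC ≤ R) (hk : 2 * R + 2 ≤ kA + kB + kC)
    (h : ll1Tensor A B C = ll1Tensor A' B' C') :
    ∃ (σ : Equiv.Perm (Fin R)) (u : Fin R → ℝ), (∀ r, u r ≠ 0) ∧
      (∀ r, C'.col r = u r • C.col (σ r)) ∧
      ∀ r, u r • (A' r * (B' r)ᵀ) = A (σ r) * (B (σ r))ᵀ := by
  have : Nonempty (Fin L) := ⟨⟨0, hL⟩⟩
  refine exists_perm_of_sum_smul_eq hA hB hC (by simpa) (by simpa) (by simpa) (by simpa) fun f => ?_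
  ext i j
  rw [← dual_apply_ll1Tensor, ← dual_apply_ll1Tensor, h]

theorem spatialDegradation_ll1Tensor {IH JH : ℕ} (P₁ : Matrix (Fin IH) (Fin I) ℝ)
    (P₂ : Matrix (Fin JH) (Fin J) ℝ) (A : Fin R → Matrix (Fin I) (Fin L) ℝ)
    (B : Fin R → Matrix (Fin J) (Fin L) ℝ) (C : Matrix (Fin K) (Fin R) ℝ) :
    spatialDegradation P₁ P₂ (ll1Tensor A B C) =
      ll1Tensor (fun r => P₁ * A r) (fun r => P₂ * B r) C := by
  ext i j k
  have h : (Matrix.of fun i' j' => ll1Tensor A B C i' j' k) = ∑ r, C k r • (A r * (B r)ᵀ) := by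
    ext i' j'
    simp [ll1Tensor, Matrix.sum_apply, mul_comm]
  simp only [spatialDegradation, ll1Tensor]
  rw [show (Matrix.of fun i' j' => ∑ r, (A r * (B r)ᵀ) i' j' * C k r) = _ from h,
    Matrix.mul_sum, Matrix.sum_mul, Matrix.sum_apply]
  refine Finset.sum_congr rfl fun r _ => ?_
  rw [Matrix.transpose_mul, Matrix.mul_smul, Matrix.smul_mul, Matrix.smul_apply, smul_eq_mul,
    mul_comm]
  simp only [Matrix.mul_assoc]

theorem spectralDegradation_ll1Tensor {KM : ℕ} (PM : Matrix (Fin KM) (Fin K) ℝ)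
    (A : Fin R → Matrix (Fin I) (Fin L) ℝ) (B : Fin R → Matrix (Fin J) (Fin L) ℝ)
    (C : Matrix (Fin K) (Fin R) ℝ) :
    spectralDegradation PM (ll1Tensor A B C) = ll1Tensor A B (PM * C) := by
  ext i j k
  simp only [spectralDegradation, ll1Tensor, Matrix.mulVec, dotProduct, Matrix.mul_apply,
    Finset.mul_sum]
  rw [Finset.sum_comm]
  exact Finset.sum_congr rfl fun r _ => Finset.sum_congr rfl fun x _ => by ring

/-- A relation between columns survives multiplication by `P`. Conditions on the degraded factors
thus serve both images. -/
theorem HasBlockRank.of_mul {m n l ι : Type*} [Fintype n] [Fintype m] [Fintype l]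
    {P : Matrix m n ℝ} {A : ι → Matrix n l ℝ} {k : ℕ} (h : HasBlockRank (fun r => P * A r) k) :
    HasBlockRank A k := fun T hT => LinearIndependent.of_comp P.mulVecLin (h T hT)

/-- A solution of the semi-blind coupled LL1 problem recovers the super-resolution image if the
degraded factors satisfy a Kruskal-type condition. -/
theorem ll1Tensor_eq_of_isSemiBlindSolution {IH JH KM : ℕ} (hL : 1 ≤ L)
    {P₁ : Matrix (Fin IH) (Fin I) ℝ} {P₂ : Matrix (Fin JH) (Fin J) ℝ}
    {PM : Matrix (Fin KM) (Fin K) ℝ} {A A' : Fin R → Matrix (Fin I) (Fin L) ℝ}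
    {B B' : Fin R → Matrix (Fin J) (Fin L) ℝ} {C C' : Matrix (Fin K) (Fin R) ℝ}
    {At : Fin R → Matrix (Fin IH) (Fin L) ℝ} {Bt : Fin R → Matrix (Fin JH) (Fin L) ℝ}
    {kA kB kC : ℕ} (hA : HasBlockRank (fun r => P₁ * A r) kA)
    (hB : HasBlockRank (fun r => P₂ * B r) kB)
    (hC : ∀ T : Finset (Fin R), T.card ≤ kC → LinearIndepOn ℝ (PM * C).col (T : Set (Fin R)))
    (hkA : kA ≤ R) (hkB : kB ≤ R) (hkC : kC ≤ R) (hk : 2 * R + 2 ≤ kA + kB + kC)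
    (h : IsSemiBlindSolution PM (spatialDegradation P₁ P₂ (ll1Tensor A B C))
      (spectralDegradation PM (ll1Tensor A B C)) At Bt A' B' C') :
    ll1Tensor A B C = ll1Tensor A' B' C' := by
  obtain ⟨hH, hM⟩ := h
  rw [spatialDegradation_ll1Tensor] at hH
  rw [spectralDegradation_ll1Tensor] at hM
  have hmul : ∀ (D : Matrix (Fin K) (Fin R) ℝ) r, (PM * D).col r = PM.mulVecLin (D.col r) :=
    fun _ _ => rfl
  have hC₀ : ∀ T : Finset (Fin R), T.card ≤ kC → LinearIndepOn ℝ C.col (T : Set (Fin R)) :=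
    fun T hT => LinearIndepOn.of_comp PM.mulVecLin (hC T hT)
  obtain ⟨σ, v, -, hv, -⟩ := exists_perm_of_ll1Tensor_eq hL hA hB hC₀ hkA hkB hkC hk hH
  obtain ⟨π, u, hu0, hu, huM⟩ :=
    exists_perm_of_ll1Tensor_eq hL hA.of_mul hB.of_mul hC hkA hkB hkC hk hM
  have hmatch : ∀ r, C'.col r = u r • C.col (π r) := by
    intro r
    have h1 : u r • (PM * C).col (π r) = v r • (PM * C).col (σ r) := by
      rw [← hu, hmul, hv, map_smul, hmul]
    have hne : ∀ s, (PM * C).col s ≠ 0 := fun s => by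
      simpa using hC {s} (by rw [Finset.card_singleton]; omega)
    have hσπ : π r = σ r := by
      by_contra hne'
      -- Here `kC ≥ 2`, because `kA, kB ≤ R`.
      have hp := hC {π r, σ r} ((Finset.card_pair hne').le.trans (by omega))
      rw [Finset.coe_pair] at hp
      have := (LinearIndepOn.pair_iff _ hne').1 hp (u r) (-v r) (by rw [h1]; simp)
      exact hu0 r this.1
    rw [← hσπ] at h1
    rw [hv, ← hσπ, smul_left_injective ℝ (hne (π r)) h1]
  ext i j k
  simp only [ll1Tensor]
  rw [← Equiv.sum_comp π]
  refine Finset.sum_congr rfl fun r _ => ?_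
  have h1 : C' k r = u r * C k (π r) := congrFun (hmatch r) k
  rw [← huM, h1, Matrix.smul_apply, smul_eq_mul]
  ring

end Main

end CoupledLL1
theorem theorem2 {Ω : Type*} [MeasurableSpace Ω] (μ : MeasureTheory.Measure Ω)
    [MeasureTheory.IsProbabilityMeasure μ]
    (IH JH KH IM JM KM L R : ℕ) (hL : 1 ≤ L)
    (P₁ : Matrix (Fin IH) (Fin IM) ℝ) (P₂ : Matrix (Fin JH) (Fin JM) ℝ)
    (PM : Matrix (Fin KM) (Fin KH) ℝ)
    (hP₁ : P₁.rank = IH) (hP₂ : P₂.rank = JH) (hPM : PM.rank = KM)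
    (A : Ω → Fin R → Matrix (Fin IM) (Fin L) ℝ)
    (B : Ω → Fin R → Matrix (Fin JM) (Fin L) ℝ)
    (C : Ω → Matrix (Fin KH) (Fin R) ℝ)
    (hABC : CoupledLL1.HasAbsContLaw μ A B C)
    (YS : Ω → CoupledLL1.Tensor3 IM JM KH)
    (YH : Ω → CoupledLL1.Tensor3 IH JH KH)
    (YM : Ω → CoupledLL1.Tensor3 IM JM KM)
    (hYS : ∀ ω, YS ω = CoupledLL1.ll1Tensor (A ω) (B ω) (C ω))
    (hYH : ∀ ω, YH ω = CoupledLL1.spatialDegradation P₁ P₂ (YS ω))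
    (hYM : ∀ ω, YM ω = CoupledLL1.spectralDegradation PM (YS ω))
    (hKM : 2 ≤ KM)
    (hIJ : L ^ 2 * R ≤ IH * JH)
    (hdim : 2 * R + 2 ≤ min (IH / L) R + min (JH / L) R + min KM R) :
    ∀ᵐ ω ∂μ,
      (∃ (At : Fin R → Matrix (Fin IH) (Fin L) ℝ) (Bt : Fin R → Matrix (Fin JH) (Fin L) ℝ)
        (A' : Fin R → Matrix (Fin IM) (Fin L) ℝ) (B' : Fin R → Matrix (Fin JM) (Fin L) ℝ)
        (C' : Matrix (Fin KH) (Fin R) ℝ),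
        CoupledLL1.IsSemiBlindSolution PM (YH ω) (YM ω) At Bt A' B' C') ∧
      ∀ (At : Fin R → Matrix (Fin IH) (Fin L) ℝ) (Bt : Fin R → Matrix (Fin JH) (Fin L) ℝ)
        (A' : Fin R → Matrix (Fin IM) (Fin L) ℝ) (B' : Fin R → Matrix (Fin JM) (Fin L) ℝ)
        (C' : Matrix (Fin KH) (Fin R) ℝ),
        CoupledLL1.IsSemiBlindSolution PM (YH ω) (YM ω) At Bt A' B' C' →
          YS ω = CoupledLL1.ll1Tensor A' B' C' := by
  obtain ⟨hmeas, hac⟩ := hABC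
  have hHaar := CoupledLL1.isAddHaarMeasure_volume_entries IM JM KH L R
  let V := (Fin R → Fin IM → Fin L → ℝ) × (Fin R → Fin JM → Fin L → ℝ) × (Fin KH → Fin R → ℝ)
  let ψA : V →ₗ[ℝ] Fin R → Matrix (Fin IM) (Fin L) ℝ :=
    { toFun := fun v r => Matrix.of (v.1 r), map_add' := fun _ _ => rfl, map_smul' := fun _ _ => rfl }
  let ψB : V →ₗ[ℝ] Fin R → Matrix (Fin JM) (Fin L) ℝ :=
    { toFun := fun v r => Matrix.of (v.2.1 r), map_add' := fun _ _ => rfl,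
      map_smul' := fun _ _ => rfl }
  let ψC : V →ₗ[ℝ] Matrix (Fin KH) (Fin R) ℝ :=
    { toFun := fun v => Matrix.of v.2.2, map_add' := fun _ _ => rfl, map_smul' := fun _ _ => rfl }
  have hψA : Function.Surjective ψA := fun a => ⟨(a, 0, 0), rfl⟩
  have hψB : Function.Surjective ψB := fun b => ⟨(0, b, 0), rfl⟩
  have hψC : Function.Surjective ψC := fun c => ⟨(0, 0, c), rfl⟩
  have hkA : min (IH / L) R * Fintype.card (Fin L) ≤ Fintype.card (Fin IH) := by
    rw [Fintype.card_fin, Fintype.card_fin]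
    exact (Nat.mul_le_mul_right _ (min_le_left _ _)).trans (Nat.div_mul_le_self _ _)
  have hkB : min (JH / L) R * Fintype.card (Fin L) ≤ Fintype.card (Fin JH) := by
    rw [Fintype.card_fin, Fintype.card_fin]
    exact (Nat.mul_le_mul_right _ (min_le_left _ _)).trans (Nat.div_mul_le_self _ _)
  have hgenA := CoupledLL1.ae_hasBlockRank_mul MeasureTheory.volume (by simpa using hP₁ : P₁.rank = _) ψA hψA hkA
  have hgenB := CoupledLL1.ae_hasBlockRank_mul MeasureTheory.volume (by simpa using hP₂ : P₂.rank = _) ψB hψB hkB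
  have hgenC := CoupledLL1.ae_linearIndepOn_col_mul MeasureTheory.volume (by simpa using hPM : PM.rank = _) ψC hψC
  -- Absolute continuity transfers Lebesgue-almost-everywhere statements to the law of the factors.
  filter_upwards [MeasureTheory.ae_of_ae_map hmeas (hac.ae_le hgenA),
    MeasureTheory.ae_of_ae_map hmeas (hac.ae_le hgenB),
    MeasureTheory.ae_of_ae_map hmeas (hac.ae_le hgenC)] with ω hA hB hC
  rw [hYM, hYH, hYS]
  refine ⟨⟨fun r => P₁ * A ω r, fun r => P₂ * B ω r, A ω, B ω, C ω,
    CoupledLL1.spatialDegradation_ll1Tensor _ _ _ _ _,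
    CoupledLL1.spectralDegradation_ll1Tensor _ _ _ _⟩, fun At Bt A' B' C' hsol => ?_⟩
  exact CoupledLL1.ll1Tensor_eq_of_isSemiBlindSolution hL hA hB
    (fun T hT => hC T (by rw [Fintype.card_fin]; exact hT.trans (min_le_left _ _)))
    (min_le_right _ _) (min_le_right _ _) (min_le_right _ _) hdim hsol
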